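/- Let $S$ be a finite set of points in the plane $\mathbb{R}^2$ in general position (no three distinct points of $S$ are collinear), with $|S|\neq 1$. Let $G$ be a crossing-free straight-edge graph on $S$: its vertex set is $S$, each edge is drawn as the straight segment between its endpoints, and two distinct edges meet at most in a common endpoint. Suppose that $G$ contains all edges of the convex hull of $S$. The faces of $G$ are the connected components of the complement in $\mathbb{R}^2$ of the union of its vertices and edges. We call $G$ a convex decomposition of $S$ if it is crossing-free, it contains all edges of the convex hull of $S$, every bounded face of $G$ is (the interior of) a convex polygon, and no point of $S$ is isolated in $G$. A point of $S$ is interior if it lies in the interior of the convex hull of $S$; an interior point $p$ is valid with respect to $G$ if there are three distinct points $a,b,c\in S$ such that $ap$, $bp$, $cp$ are edges of $G$ and $p$ lies in the convex hull of $\{a,b,c\}$. Then $G$ is a convex decomposition of $S$ if and only if every interior point of $S$ is valid with respect to $G$. -/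

import Mathlib

namespace PlaneGraph

/-- The Euclidean plane. -/
abbrev Plane := EuclideanSpace ℝ (Fin 2)

/-- No three distinct points of `S` lie on a line. -/
def GeneralPosition (S : Finset Plane) : Prop :=
  ∀ a ∈ S, ∀ b ∈ S, ∀ c ∈ S, a ≠ b → a ≠ c → b ≠ c →
    ¬ Collinear ℝ ({a, b, c} : Set Plane)

variable {S : Finset Plane}

/-- The graph `G` on the point set `S`, with every edge drawn as the straight segment between its
endpoints, is crossing-free: two distinct edges meet at most in a common endpoint. -/
def IsCrossingFree (G : SimpleGraph S) : Prop :=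
  ∀ a b c d : S, G.Adj a b → G.Adj c d → s(a, b) ≠ s(c, d) →
    segment ℝ (a : Plane) (b : Plane) ∩ segment ℝ (c : Plane) (d : Plane) ⊆
      ({(a : Plane), (b : Plane)} : Set Plane) ∩ {(c : Plane), (d : Plane)}

/-- The segment between the distinct points `a`, `b` of `S` is an edge of the convex hull of `S`:
it lies on the boundary of the hull. -/
def IsHullEdge (a b : S) : Prop :=
  a ≠ b ∧ segment ℝ (a : Plane) (b : Plane) ⊆ frontier (convexHull ℝ (S : Set Plane))

/-- `G` contains all edges of the convex hull of `S`. -/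
def ContainsHullEdges (G : SimpleGraph S) : Prop :=
  ∀ a b : S, IsHullEdge a b → G.Adj a b

/-- The subset of the plane occupied by the vertices and the edges of `G`. -/
def drawing (G : SimpleGraph S) : Set Plane :=
  {x | x ∈ S ∨ ∃ a b : S, G.Adj a b ∧ x ∈ segment ℝ (a : Plane) (b : Plane)}

/-- The faces of `G` are the connected components of the complement of its drawing. -/
def IsFace (G : SimpleGraph S) (F : Set Plane) : Prop :=
  ∃ x ∈ (drawing G)ᶜ, F = connectedComponentIn (drawing G)ᶜ x

/-- The open region `F` is (the interior of) a convex polygon. -/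
def IsConvexPolygon (F : Set Plane) : Prop :=
  F.Nonempty ∧ ∃ V : Finset Plane, F = interior (convexHull ℝ (V : Set Plane))

/-- `G` is a convex decomposition of `S`. -/
structure IsConvexDecomposition (G : SimpleGraph S) : Prop where
  crossingFree : IsCrossingFree G
  hullEdges : ContainsHullEdges G
  convexFaces : ∀ F : Set Plane, IsFace G F → Bornology.IsBounded F → IsConvexPolygon F
  noIsolated : ∀ p : S, ∃ q : S, G.Adj p q

/-- `p` is an interior point of `S`. -/
def IsInteriorPoint (p : S) : Prop :=
  (p : Plane) ∈ interior (convexHull ℝ (S : Set Plane))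

/-- `p` has a valid triple of edges in `G`: three distinct neighbours whose convex hull
contains `p`. -/
def IsValid (G : SimpleGraph S) (p : S) : Prop :=
  ∃ a b c : S, a ≠ b ∧ a ≠ c ∧ b ≠ c ∧ G.Adj a p ∧ G.Adj b p ∧ G.Adj c p ∧
    (p : Plane) ∈ convexHull ℝ ({(a : Plane), (b : Plane), (c : Plane)} : Set Plane)

end PlaneGraph

namespace PlaneGraph

open Set Filter Topology

/-! If an interior point `p` is not valid, Carathéodory and general position put it outside the hull
of its neighbours, so all edges at `p` leave into one open half-plane bounded by a line through `p`.
Near `p`, that line without `p` lies in a single bounded face, which is not convex because it misses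
the midpoint `p` (`isValid_of_isConvexDecomposition`).

Conversely, let `F` be a bounded face. The relation "the segment from `x` to `y` lies in `F`" holds
locally, so by connectedness `F` is convex once the relation is transitive (`IsFace.segment_trans`).
Given sides `xz` and `zy` in `F`, sweep a line parallel to `xy` across the triangle, starting at
`z`. If the drawing is met at all, the first point met, with ties broken along the line, is a vertex
that is not valid (`not_isValid_of_lex_min`), yet it is interior to the hull. The extreme points of
the closure of a face are vertices (`IsFace.extremePoints_subset`), so Krein–Milman makes a convex
bounded face a polygon. No point is isolated: interior points have valid triples, the others lie on
hull edges (`exists_isHullEdge`). -/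

/-! ### Supporting functionals and general position -/

/-- A supporting functional of a convex hull in finite dimension, at a point of the hull which is
not interior; the hull may have empty interior. -/

lemma exists_support {S : Set Plane} {p : Plane} (hp : p ∈ convexHull ℝ S)
    (hpi : p ∉ interior (convexHull ℝ S)) :
    ∃ f : Plane →L[ℝ] ℝ, f ≠ 0 ∧ ∀ q ∈ S, f p ≤ f q := by
  by_cases hne : (interior (convexHull ℝ S)).Nonempty
  · obtain ⟨f, hf, h⟩ := geometric_hahn_banach_of_nonempty_interior_point
      (convex_convexHull ℝ S) hpi hne
    exact ⟨-f, neg_ne_zero.2 hf, fun q hq => by simpa using h q (subset_convexHull ℝ S hq)⟩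
  -- The affine span is proper here, so a nonzero functional killing its direction is constant on
  -- `S`.
  · rw [interior_convexHull_nonempty_iff_affineSpan_eq_top] at hne
    have hpS : p ∈ affineSpan ℝ S := convexHull_subset_affineSpan S hp
    have hdir : (affineSpan ℝ S).direction < ⊤ := by
      rw [lt_top_iff_ne_top]
      exact fun h => hne ((AffineSubspace.direction_eq_top_iff_of_nonempty ⟨p, hpS⟩).1 h)
    obtain ⟨f, hf, hker⟩ := Submodule.exists_le_ker_of_lt_top _ hdir
    refine ⟨LinearMap.toContinuousLinearMap f, by simpa using hf, fun q hq => ?_⟩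
    have := hker (AffineSubspace.vsub_mem_direction (subset_affineSpan ℝ S hq) hpS)
    simp only [vsub_eq_sub, LinearMap.mem_ker, map_sub] at this
    simp only [LinearMap.coe_toContinuousLinearMap']
    linarith

lemma exists_apply_neg {f : Plane →L[ℝ] ℝ} (hf : f ≠ 0) : ∃ v, f v < 0 := by
  obtain ⟨v, hv⟩ : ∃ v, f v ≠ 0 := by
    by_contra! h
    exact hf (ContinuousLinearMap.ext h)
  rcases lt_or_gt_of_ne hv with h | h
  · exact ⟨v, h⟩
  · exact ⟨-v, by simpa using h⟩

/-- Points on a common line of the plane are collinear. -/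

lemma collinear_of_apply_eq {f : Plane →L[ℝ] ℝ} (hf : f ≠ 0) {T : Set Plane} {r : ℝ}
    (hT : ∀ x ∈ T, f x = r) : Collinear ℝ T := by
  have hle : vectorSpan ℝ T ≤ LinearMap.ker f.toLinearMap := by
    rw [vectorSpan, Submodule.span_le]
    rintro _ ⟨x, hx, y, hy, rfl⟩
    simp [hT x hx, hT y hy]
  have hf' : f.toLinearMap ≠ 0 := fun h => hf (ContinuousLinearMap.coe_injective h)
  have hrank := f.toLinearMap.finrank_range_add_finrank_ker
  rw [LinearMap.range_eq_top.2 (LinearMap.surjective hf'), finrank_top, Module.finrank_self,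
    finrank_euclideanSpace_fin] at hrank
  rw [collinear_iff_finrank_le_one]
  exact (Submodule.finrank_mono hle).trans (by omega)

lemma exists_ker_vector (f : Plane →L[ℝ] ℝ) : ∃ v, v ≠ 0 ∧ f v = 0 := by
  have hrank := f.toLinearMap.finrank_range_add_finrank_ker
  have h1 := Submodule.finrank_le (LinearMap.range f.toLinearMap)
  rw [Module.finrank_self] at h1
  rw [finrank_euclideanSpace_fin] at hrank
  have : LinearMap.ker f.toLinearMap ≠ ⊥ := by
    intro h
    rw [h, finrank_bot] at hrank
    omega
  obtain ⟨v, hv, hv0⟩ := Submodule.exists_mem_ne_zero_of_ne_bot this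
  exact ⟨v, hv0, by simpa using hv⟩

/-- A point of the hull at which a functional is minimal lies in the hull of the minimisers. -/

lemma mem_convexHull_face {f : Plane →L[ℝ] ℝ} {N : Set Plane} {q : Plane}
    (hq : q ∈ convexHull ℝ N) (hf : ∀ x ∈ N, f q ≤ f x) :
    q ∈ convexHull ℝ {x ∈ N | f x = f q} := by
  obtain ⟨ι, _, w, z, hw, hw1, hz, rfl⟩ := mem_convexHull_iff_exists_fintype.1 hq
  set q := ∑ i, w i • z i
  have hsum : ∑ i, w i * (f (z i) - f q) = 0 := by
    simp only [mul_sub, Finset.sum_sub_distrib, ← Finset.sum_mul, hw1, one_mul]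
    simp [q]
  rw [Finset.sum_eq_zero_iff_of_nonneg
    (fun i _ => mul_nonneg (hw i) (sub_nonneg.2 (hf _ (hz i))))] at hsum
  have hcm : Finset.univ.centerMass w z = q := Finset.centerMass_eq_of_sum_1 _ _ hw1
  classical
  rw [← hcm, ← Finset.centerMass_filter_ne_zero]
  refine Finset.centerMass_mem_convexHull _ (fun i _ => hw i) ?_ fun i hi => ⟨hz i, ?_⟩
  · rw [Finset.sum_filter_ne_zero, hw1]
    exact one_pos
  · rw [Finset.centerMass_filter_ne_zero, hcm]
    exact sub_eq_zero.1 ((mul_eq_zero.1 (hsum i (Finset.mem_univ i))).resolve_left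
      (Finset.mem_filter.1 hi).2)

lemma GeneralPosition.eq_or_eq {S : Finset Plane} (hS : GeneralPosition S) {f : Plane →L[ℝ] ℝ}
    (hf : f ≠ 0) {a b c : Plane} (ha : a ∈ S) (hb : b ∈ S) (hc : c ∈ S) (hab : a ≠ b)
    (h₁ : f a = f b) (h₂ : f c = f b) : c = a ∨ c = b := by
  by_contra! h
  refine hS a ha b hb c hc hab h.1.symm h.2.symm (collinear_of_apply_eq hf (r := f b) ?_)
  simp [h₁, h₂]

lemma GeneralPosition.eq_or_eq_of_mem_segment {S : Finset Plane} (hS : GeneralPosition S)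
    {a b c : Plane} (ha : a ∈ S) (hb : b ∈ S) (hc : c ∈ S) (h : c ∈ segment ℝ a b) :
    c = a ∨ c = b := by
  by_contra! hne
  rcases eq_or_ne a b with rfl | hab
  · simp at h
    exact hne.1 h
  · refine hS a ha b hb c hc hab hne.1.symm hne.2.symm ?_
    have := (mem_segment_iff_wbtw.1 h).collinear
    rwa [Set.pair_comm c b] at this

lemma tendsto_add_smul (p v : Plane) : Tendsto (fun t : ℝ => p + t • v) (𝓝[>] 0) (𝓝 p) := by
  have : Tendsto (fun t : ℝ => p + t • v) (𝓝 0) (𝓝 (p + (0 : ℝ) • v)) :=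
    Continuous.tendsto (by fun_prop) 0
  simpa using this.mono_left nhdsWithin_le_nhds

/-! ### Edges of the convex hull -/

lemma isHullEdge_of_support {S : Finset Plane} {f : Plane →L[ℝ] ℝ} (hf : f ≠ 0) {a b : S}
    (hab : a ≠ b) (hfab : f a = f b) (hmin : ∀ q ∈ S, f a ≤ f q) : IsHullEdge a b := by
  refine ⟨hab, fun y hy => ?_⟩
  have hyS : y ∈ convexHull ℝ (S : Set Plane) :=
    (convex_convexHull ℝ _).segment_subset (subset_convexHull ℝ _ a.2) (subset_convexHull ℝ _ b.2) hy
  have hge : ∀ z ∈ convexHull ℝ (S : Set Plane), f a ≤ f z :=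
    convexHull_min (t := {z | f a ≤ f z}) (fun z hz => hmin z hz)
      (convex_halfSpace_ge f.toLinearMap.isLinear _)
  have hfy : f y = f a := by
    obtain ⟨s, t, _, _, hst, rfl⟩ := hy
    simp only [map_add, map_smul, smul_eq_mul, ← hfab, ← add_mul, hst, one_mul]
  refine ⟨subset_closure hyS, fun hint => ?_⟩
  obtain ⟨v, hv⟩ := exists_apply_neg hf
  obtain ⟨t, ht, ht0⟩ := (((tendsto_add_smul y v).eventually (mem_interior_iff_mem_nhds.1 hint)).and
    self_mem_nhdsWithin).exists
  have h1 := hge _ ht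
  simp only [map_add, map_smul, smul_eq_mul, hfy] at h1
  have : t * f v < 0 := mul_neg_of_pos_of_neg ht0 hv
  linarith

/-- A boundary point lies in the hull of the minimisers of a supporting functional. General position
allows at most two: one gives a vertex, two give a hull edge. -/
lemma frontier_subset_drawing {S : Finset Plane} (hS : GeneralPosition S) {G : SimpleGraph S}
    (hhull : ContainsHullEdges G) : frontier (convexHull ℝ (S : Set Plane)) ⊆ drawing G := by
  intro x hx
  have hxS : x ∈ convexHull ℝ (S : Set Plane) :=
    (S.finite_toSet.isClosed_convexHull ℝ).frontier_subset hx
  obtain ⟨f, hf, hmin⟩ := exists_support hxS hx.2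
  have hface := mem_convexHull_face hxS hmin
  obtain ⟨a, haS, hfa⟩ := convexHull_nonempty_iff.1 ⟨x, hface⟩
  by_cases h : ∃ b ∈ S, f b = f x ∧ a ≠ b
  · obtain ⟨b, hbS, hfb, hab⟩ := h
    have hsub : {y ∈ (S : Set Plane) | f y = f x} ⊆ {a, b} := fun c hc =>
      hS.eq_or_eq hf haS hbS hc.1 hab (hfa.trans hfb.symm) (hc.2.trans hfb.symm)
    have hseg := convexHull_mono hsub hface
    rw [convexHull_pair] at hseg
    refine Or.inr ⟨⟨a, haS⟩, ⟨b, hbS⟩, hhull _ _ (isHullEdge_of_support hf ?_ ?_ ?_), hseg⟩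
    · simpa using hab
    · exact hfa.trans hfb.symm
    · intro q hq
      exact hfa.trans_le (hmin q hq)
  · push Not at h
    have hsub : {y ∈ (S : Set Plane) | f y = f x} ⊆ {a} := fun c hc => (h c hc.1 hc.2).symm
    have := convexHull_mono hsub hface
    rw [convexHull_singleton] at this
    exact Or.inl (this ▸ haS)

/-- Every vertex on the boundary of the hull is an endpoint of a hull edge. -/

lemma exists_isHullEdge {S : Finset Plane} (hcard : S.card ≠ 1) (p : S)
    (hp : ¬ IsInteriorPoint p) : ∃ q : S, IsHullEdge p q := by
  obtain ⟨f, hf, hmin⟩ := exists_support (subset_convexHull ℝ (S : Set Plane) p.2) hp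
  by_cases h : ∃ q : S, p ≠ q ∧ f p = f q
  · obtain ⟨q, hpq, hq⟩ := h
    exact ⟨q, isHullEdge_of_support hf hpq hq hmin⟩
  push Not at h
  have hpos : ∀ q : S, q ≠ p → 0 < f (q - p) := fun q hq => by
    rw [map_sub, sub_pos]
    exact lt_of_le_of_ne (hmin q q.2) (h q hq.symm)
  -- When `p` is the only minimiser, tilt the supporting line about `p` until it hits another point:
  -- the maximal slope of `g` against `f` is attained at `q`, and `c • f - g` supports `S` at both
  -- `p` and `q`.
  obtain ⟨v, hv0, hv⟩ := exists_ker_vector f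
  set g : Plane →L[ℝ] ℝ := innerSL ℝ v
  have hgv : g v ≠ 0 := by
    simpa [g] using hv0
  have hne : (Finset.univ.erase p).Nonempty := by
    rw [← Finset.card_pos, Finset.card_erase_of_mem (Finset.mem_univ p), Finset.card_univ,
      Fintype.card_coe]
    have : 0 < S.card := Finset.card_pos.2 ⟨p, p.2⟩
    omega
  obtain ⟨q, hq, hmax⟩ := Finset.exists_max_image _ (fun q : S => g (q - p) / f (q - p)) hne
  have hqp := Finset.ne_of_mem_erase hq
  set c := g (q - p) / f (q - p)
  have hle : ∀ x : S, (c • f - g) p ≤ (c • f - g) x := by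
    intro x
    rcases eq_or_ne x p with rfl | hx
    · exact le_rfl
    · have h1 := hmax x (Finset.mem_erase.2 ⟨hx, Finset.mem_univ x⟩)
      rw [div_le_iff₀ (hpos x hx)] at h1
      simp only [map_sub, mul_sub] at h1
      simp only [sub_apply, smul_apply, smul_eq_mul]
      linarith
  refine ⟨q, isHullEdge_of_support (f := c • f - g) ?_ hqp.symm ?_ fun x hx => hle ⟨x, hx⟩⟩
  · intro h0
    have := congrArg (fun k : Plane →L[ℝ] ℝ => k v) h0
    simp [hv] at this
    exact hv0 (by simpa [g] using this)
  · have h1 : g (q - p) = c * f (q - p) := (div_mul_cancel₀ _ (hpos q hqp).ne').symm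
    simp only [map_sub, mul_sub] at h1
    simp only [sub_apply, smul_apply, smul_eq_mul]
    linarith

/-! ### Topology of the drawing and its faces -/

lemma segment_subset_drawing {S : Finset Plane} {G : SimpleGraph S} {a b : S} (h : G.Adj a b) :
    segment ℝ (a : Plane) b ⊆ drawing G := fun _ hx => Or.inr ⟨a, b, h, hx⟩

lemma isClosed_segment (a b : Plane) : IsClosed (segment ℝ a b) := by
  rw [← convexHull_pair]
  exact (Set.toFinite _).isClosed_convexHull ℝ

lemma isClosed_drawing {S : Finset Plane} (G : SimpleGraph S) : IsClosed (drawing G) := by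
  have : drawing G = (S : Set Plane) ∪
      ⋃ e ∈ {e : S × S | G.Adj e.1 e.2}, segment ℝ (e.1 : Plane) e.2 := by
    ext x
    simp [drawing]
  rw [this]
  exact S.finite_toSet.isClosed.union
    ((Set.toFinite _).isClosed_biUnion fun e _ => isClosed_segment _ _)

lemma drawing_subset_convexHull {S : Finset Plane} (G : SimpleGraph S) :
    drawing G ⊆ convexHull ℝ (S : Set Plane) := by
  rintro x (hx | ⟨a, b, -, hx⟩)
  · exact subset_convexHull ℝ _ hx
  · exact (convex_convexHull ℝ _).segment_subset (subset_convexHull ℝ _ a.2)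
      (subset_convexHull ℝ _ b.2) hx

/-- Near a point, only the edges through that point are visible. -/

lemma eventually_mem_drawing {S : Finset Plane} (G : SimpleGraph S) (e : Plane) :
    ∀ᶠ x in 𝓝 e, x ∈ drawing G → x = e ∨
      ∃ a b : S, G.Adj a b ∧ e ∈ segment ℝ (a : Plane) b ∧ x ∈ segment ℝ (a : Plane) b := by
  have h1 : ∀ᶠ x in 𝓝 e, ∀ q : S, e ≠ (q : Plane) → x ≠ (q : Plane) := by
    rw [eventually_all]
    intro q
    by_cases h : e = (q : Plane)
    · simp [h]
    · filter_upwards [isOpen_ne.mem_nhds h] with x hx _ using hx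
  have h2 : ∀ᶠ x in 𝓝 e, ∀ c : S × S, e ∉ segment ℝ (c.1 : Plane) c.2 →
      x ∉ segment ℝ (c.1 : Plane) c.2 := by
    rw [eventually_all]
    intro c
    by_cases h : e ∈ segment ℝ (c.1 : Plane) c.2
    · simp [h]
    · filter_upwards [(isClosed_segment _ _).isOpen_compl.mem_nhds h] with x hx _ using hx
  filter_upwards [h1, h2] with x hx1 hx2
  rintro (hx | ⟨a, b, hab, hx⟩)
  · left
    by_contra hne
    refine hx1 ⟨x, hx⟩ (Ne.symm hne) rfl
  · right
    refine ⟨a, b, hab, ?_, hx⟩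
    by_contra h
    exact hx2 (a, b) h hx

section Face

variable {S : Finset Plane} {G : SimpleGraph S} {F : Set Plane}

lemma IsFace.isOpen (hF : IsFace G F) : IsOpen F := by
  obtain ⟨x, -, rfl⟩ := hF
  exact (isClosed_drawing G).isOpen_compl.connectedComponentIn

lemma IsFace.isPreconnected (hF : IsFace G F) : IsPreconnected F := by
  obtain ⟨x, -, rfl⟩ := hF
  exact isPreconnected_connectedComponentIn

lemma IsFace.nonempty (hF : IsFace G F) : F.Nonempty := by
  obtain ⟨x, hx, rfl⟩ := hF
  exact ⟨x, mem_connectedComponentIn hx⟩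

lemma IsFace.subset_compl (hF : IsFace G F) : F ⊆ (drawing G)ᶜ := by
  obtain ⟨x, -, rfl⟩ := hF
  exact connectedComponentIn_subset _ _

lemma IsFace.subset_of_isPreconnected (hF : IsFace G F) {T : Set Plane} (hT : IsPreconnected T)
    (hTG : T ⊆ (drawing G)ᶜ) {y : Plane} (hyT : y ∈ T) (hyF : y ∈ F) : T ⊆ F := by
  obtain ⟨x, -, rfl⟩ := hF
  rw [connectedComponentIn_eq hyF]
  exact hT.subset_connectedComponentIn hyT hTG

/-- A bounded face lies in the interior of the hull. -/

lemma IsFace.subset_interior (hF : IsFace G F)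
    (hfr : frontier (convexHull ℝ (S : Set Plane)) ⊆ drawing G) (hb : Bornology.IsBounded F) :
    F ⊆ interior (convexHull ℝ (S : Set Plane)) := by
  intro x hx
  by_contra hxi
  by_cases hxS : x ∈ convexHull ℝ (S : Set Plane)
  · exact hF.subset_compl hx (hfr ⟨subset_closure hxS, hxi⟩)
  obtain ⟨f, u, hfu, hf⟩ := geometric_hahn_banach_point_closed (convex_convexHull ℝ _)
    (S.finite_toSet.isClosed_convexHull ℝ) hxS
  have hsub : {y | f y ≤ f x} ⊆ F := by
    refine hF.subset_of_isPreconnected (convex_halfSpace_le f.toLinearMap.isLinear _).isPreconnected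
      (fun y hy hyG => ?_) (y := x) (le_refl (f x)) hx
    have := hf y (drawing_subset_convexHull G hyG)
    exact absurd hy (not_le.2 (hfu.trans this))
  -- The half-plane contains a whole line through `x`; a displacement of length `2R + 1` along it
  -- exceeds the `2R` allowed between points of norm at most `R`.
  obtain ⟨v, hv0, hv⟩ := exists_ker_vector f
  obtain ⟨R, hR⟩ := (hb.subset hsub).exists_norm_le
  have h1 : ∀ t : ℝ, ‖x + t • v‖ ≤ R := fun t => hR _ (by simp [hv])
  have h2 := h1 ((R + R + 1) / ‖v‖)
  have h3 := h1 0
  have hvn : ‖v‖ ≠ 0 := norm_ne_zero_iff.2 hv0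
  have h4 : ‖((R + R + 1) / ‖v‖) • v‖ = |R + R + 1| := by
    rw [norm_smul, norm_div, norm_norm, div_mul_cancel₀ _ hvn, Real.norm_eq_abs]
  have h5 := norm_sub_le (x + ((R + R + 1) / ‖v‖) • v) x
  rw [add_sub_cancel_left, h4] at h5
  rw [zero_smul, add_zero] at h3
  linarith [le_abs_self (R + R + 1)]

/-- The hull boundary is drawn, so a connected face that starts inside cannot get out. -/
lemma IsFace.isBounded (hF : IsFace G F)
    (hfr : frontier (convexHull ℝ (S : Set Plane)) ⊆ drawing G) {x : Plane} (hx : x ∈ F)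
    (hxi : x ∈ interior (convexHull ℝ (S : Set Plane))) : Bornology.IsBounded F := by
  have hcl := S.finite_toSet.isClosed_convexHull ℝ
  have hsub : F ⊆ interior (convexHull ℝ (S : Set Plane)) := by
    refine hF.isPreconnected.subset_left_of_subset_union isOpen_interior hcl.isOpen_compl
      (disjoint_compl_right.mono_left interior_subset) (fun y hy => ?_) ⟨x, hx, hxi⟩
    by_contra h
    simp only [mem_union, mem_compl_iff, not_or, not_not] at h
    exact hF.subset_compl hy (hfr ⟨subset_closure h.2, h.1⟩)
  exact (S.finite_toSet.isCompact_convexHull ℝ).isBounded.subset (hsub.trans interior_subset)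

end Face

/-! ### Convex faces force valid interior points -/

/-- Carathéodory gives at most three neighbours; general position excludes two, so there are exactly
three distinct ones. -/
lemma isValid_of_mem_convexHull {S : Finset Plane} (hS : GeneralPosition S) {G : SimpleGraph S}
    {p : S} (h : (p : Plane) ∈ convexHull ℝ ((↑) '' {a : S | G.Adj a p} : Set Plane)) :
    IsValid G p := by
  rw [convexHull_eq_union] at h
  simp only [mem_iUnion] at h
  obtain ⟨t, htN, hind, hpt⟩ := h
  have hcard : t.card ≤ 3 := by
    have := hind.card_le_finrank_succ
    have h2 := Submodule.finrank_le (vectorSpan ℝ (Set.range ((↑) : t → Plane)))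
    rw [finrank_euclideanSpace_fin] at h2
    rw [Fintype.card_coe] at this
    omega
  have hN : ∀ x ∈ t, ∃ a : S, G.Adj a p ∧ (a : Plane) = x := fun x hx => by
    simpa using htN hx
  interval_cases hc : t.card
  · rw [Finset.card_eq_zero] at hc
    simp [hc] at hpt
  · obtain ⟨x, rfl⟩ := Finset.card_eq_one.1 hc
    obtain ⟨a, ha, rfl⟩ := hN x (by simp)
    simp only [Finset.coe_singleton, convexHull_singleton, mem_singleton_iff] at hpt
    exact absurd (Subtype.ext hpt).symm ha.ne
  · obtain ⟨x, y, -, rfl⟩ := Finset.card_eq_two.1 hc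
    obtain ⟨a, ha, rfl⟩ := hN x (by simp)
    obtain ⟨b, hb, rfl⟩ := hN y (by simp)
    rw [Finset.coe_pair, convexHull_pair] at hpt
    rcases hS.eq_or_eq_of_mem_segment a.2 b.2 p.2 hpt with h | h
    · exact absurd (Subtype.ext h).symm ha.ne
    · exact absurd (Subtype.ext h).symm hb.ne
  · obtain ⟨x, y, z, hxy, hxz, hyz, rfl⟩ := Finset.card_eq_three.1 hc
    obtain ⟨a, ha, rfl⟩ := hN x (by simp)
    obtain ⟨b, hb, rfl⟩ := hN y (by simp)
    obtain ⟨c, hcp, rfl⟩ := hN z (by simp)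
    refine ⟨a, b, c, ?_, ?_, ?_, ha, hb, hcp, by simpa using hpt⟩
    · rintro rfl; exact hxy rfl
    · rintro rfl; exact hxz rfl
    · rintro rfl; exact hyz rfl

lemma isValid_of_isConvexDecomposition {S : Finset Plane} (hS : GeneralPosition S)
    {G : SimpleGraph S} (hG : IsConvexDecomposition G) {p : S} (hp : IsInteriorPoint p) :
    IsValid G p := by
  by_contra hval
  have hpN := mt (isValid_of_mem_convexHull hS) hval
  obtain ⟨f, u, hfu, hf⟩ := geometric_hahn_banach_point_closed (convex_convexHull ℝ _)
    ((Set.toFinite _).isClosed_convexHull ℝ) hpN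
  have hnbr : ∀ a : S, G.Adj a p → f p < f a := fun a ha =>
    hfu.trans (hf a (subset_convexHull ℝ _ ⟨a, ha, rfl⟩))
  -- near `p` the closed half-plane `f ≤ f p` meets the drawing in `p` only
  have hfree : ∀ᶠ x in 𝓝 (p : Plane), x ∈ interior (convexHull ℝ (S : Set Plane)) ∧
      (x ≠ p → f x ≤ f p → x ∉ drawing G) := by
    filter_upwards [eventually_mem_drawing G p, isOpen_interior.mem_nhds hp] with x hx hxi
    refine ⟨hxi, fun hxp hfx hxG => ?_⟩
    have key : ∀ a : S, G.Adj a p → x ∈ segment ℝ (a : Plane) p → False := by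
      rintro a ha ⟨s, t, hs, _, hst, rfl⟩
      have hs0 : s ≠ 0 := by
        rintro rfl
        obtain rfl : t = 1 := by linarith
        simp at hxp
      simp only [map_add, map_smul, smul_eq_mul] at hfx
      have := mul_pos (lt_of_le_of_ne hs hs0.symm) (sub_pos.2 (hnbr a ha))
      obtain rfl : t = 1 - s := by linarith
      linarith
    rcases hx hxG with h | ⟨a, b, hab, hpab, hxab⟩
    · exact hxp h
    · rcases hS.eq_or_eq_of_mem_segment a.2 b.2 p.2 hpab with h | h
      · obtain rfl : p = a := Subtype.ext h
        exact key b hab.symm (segment_symm ℝ (p : Plane) b ▸ hxab)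
      · obtain rfl : p = b := Subtype.ext h
        exact key a hab hxab
  obtain ⟨r, hr, hball⟩ := Metric.eventually_nhds_iff_ball.1 hfree
  obtain ⟨v, hv0, hv⟩ := exists_ker_vector f
  -- Separation from an empty set of neighbours would allow `f = 0`; having a neighbour rules this
  -- out.
  obtain ⟨w, hw⟩ : ∃ w, f w < 0 := by
    obtain ⟨a, ha⟩ := hG.noIsolated p
    refine ⟨p - a, ?_⟩
    rw [map_sub, sub_neg]
    exact hnbr a ha.symm
  have hseg : ∀ v', v' ≠ 0 → f v' = 0 → ∀ t : ℝ, 0 < t → ↑p + t • v' ∈ Metric.ball (p : Plane) r →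
      ↑p + t • w ∈ Metric.ball (p : Plane) r →
      segment ℝ (↑p + t • v') (↑p + t • w) ⊆ (drawing G)ᶜ := by
    intro v' hv'0 hv' t ht h1 h2 x hx
    refine (hball x ((convex_ball _ _).segment_subset h1 h2 hx)).2 ?_ ?_
    all_goals obtain ⟨s, s', hs, hs', hss, rfl⟩ := hx
    · intro h
      have h3 := congrArg f h
      obtain rfl : s = 1 - s' := by linarith
      simp only [map_add, map_smul, smul_eq_mul, hv'] at h3
      have h4 : s' * (t * f w) = 0 := by linarith
      have h5 : s' = 0 := (mul_eq_zero.1 h4).resolve_right (mul_ne_zero ht.ne' hw.ne)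
      subst h5
      simp [ht.ne', hv'0] at h
    · obtain rfl : s = 1 - s' := by linarith
      simp only [map_add, map_smul, smul_eq_mul, hv']
      have : s' * (t * f w) ≤ 0 :=
        mul_nonpos_of_nonneg_of_nonpos hs' (mul_nonpos_of_nonneg_of_nonpos ht.le hw.le)
      linarith
  have hmem := fun v' => (tendsto_add_smul (p : Plane) v').eventually (Metric.ball_mem_nhds _ hr)
  obtain ⟨t, ⟨⟨⟨htv, htv'⟩, htw⟩, ht⟩⟩ :=
    ((((hmem v).and (hmem (-v))).and (hmem w)).and self_mem_nhdsWithin).exists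
  -- The points `p ± t • v` are joined around `p` through `p + t • w`, hence share a face.
  have hA := hseg v hv0 hv t ht htv htw
  have hB := hseg (-v) (neg_ne_zero.2 hv0) (by simp [hv]) t ht htv' htw
  have hWG : ↑p + t • w ∈ (drawing G)ᶜ := hA (right_mem_segment _ _ _)
  have hF : IsFace G (connectedComponentIn (drawing G)ᶜ (↑p + t • w)) := ⟨_, hWG, rfl⟩
  have hWF := mem_connectedComponentIn hWG
  have hAF := hF.subset_of_isPreconnected (convex_segment _ _).isPreconnected hA
    (right_mem_segment _ _ _) hWF (left_mem_segment _ _ _)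
  have hBF := hF.subset_of_isPreconnected (convex_segment _ _).isPreconnected hB
    (right_mem_segment _ _ _) hWF (left_mem_segment _ _ _)
  obtain ⟨-, V, hV⟩ := hG.convexFaces _ hF
    (hF.isBounded (frontier_subset_drawing hS hG.hullEdges) hWF (hball _ htw).1)
  have hconv : Convex ℝ (connectedComponentIn (drawing G)ᶜ (↑p + t • w)) := by
    rw [hV]
    exact (convex_convexHull ℝ _).interior
  refine hF.subset_compl (hconv.segment_subset hAF hBF ?_) (Or.inl p.2)
  exact ⟨1 / 2, 1 / 2, by norm_num, by norm_num, by norm_num, by module⟩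

/-! ### Valid interior points force convex faces -/

/-- Coordinate functionals of a basis of the plane. -/

lemma exists_coordinates {u v : Plane} (h : LinearIndependent ℝ ![u, v]) :
    ∃ f g : Plane →L[ℝ] ℝ, f u = 1 ∧ f v = 0 ∧ g u = 0 ∧ g v = 1 ∧
      ∀ w, w = f w • u + g w • v := by
  set b := basisOfLinearIndependentOfCardEqFinrank h (by simp)
  have h0 : b 0 = u := by simp [b]
  have h1 : b 1 = v := by simp [b]
  refine ⟨LinearMap.toContinuousLinearMap (b.coord 0),
    LinearMap.toContinuousLinearMap (b.coord 1), ?_, ?_, ?_, ?_, fun w => ?_⟩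
  · simp [← h0]
  · simp [← h1]
  · simp [← h0]
  · simp [← h1]
  · have := b.sum_repr w
    rw [Fin.sum_univ_two, h0, h1] at this
    simpa using this.symm

/-- On a compact set, two functionals have a lexicographic minimum. -/

lemma exists_lex_min {K : Set Plane} (hK : IsCompact K) (hne : K.Nonempty)
    (f g : Plane →L[ℝ] ℝ) :
    ∃ q ∈ K, (∀ x ∈ K, f q ≤ f x) ∧ ∀ x ∈ K, f x = f q → g q ≤ g x := by
  obtain ⟨q₀, hq₀, hmin⟩ := hK.exists_isMinOn hne f.continuous.continuousOn
  have hK' : IsCompact (K ∩ {x | f x = f q₀}) :=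
    hK.inter_right (isClosed_eq f.continuous continuous_const)
  obtain ⟨q, hq, hmin'⟩ := hK'.exists_isMinOn ⟨q₀, hq₀, rfl⟩ g.continuous.continuousOn
  refine ⟨q, hq.1, fun x hx => ?_, fun x hx hfx => hmin' ⟨hx, hfx.trans hq.2⟩⟩
  rw [hq.2]
  exact hmin hx

/-- A point of the drawing which is lexicographically minimal among the nearby points of the
drawing is a vertex which is not valid. -/

lemma not_isValid_of_lex_min {S : Finset Plane} (hS : GeneralPosition S) {G : SimpleGraph S}
    {f g : Plane →L[ℝ] ℝ} (hfg : ∀ w, f w = 0 → g w = 0 → w = 0) {q : Plane} (hq : q ∈ drawing G)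
    (hf0 : f ≠ 0)
    (hf : ∀ᶠ x in 𝓝 q, x ∈ drawing G → f q ≤ f x)
    (hg : ∀ᶠ x in 𝓝 q, x ∈ drawing G → f x = f q → g q ≤ g x) :
    ∃ p : S, (p : Plane) = q ∧ ¬ IsValid G p := by
  have hstar : ∀ n, segment ℝ q n ⊆ drawing G → f q ≤ f n ∧ (f n = f q → g q ≤ g n) := by
    intro n hn
    obtain ⟨t, ⟨⟨hft, hgt⟩, ht1⟩, ht0⟩ := (((tendsto_add_smul q (n - q)).eventually
      (hf.and hg)).and (nhdsWithin_le_nhds (gt_mem_nhds (zero_lt_one' ℝ))) |>.and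
      self_mem_nhdsWithin).exists
    have ht0 : 0 < t := ht0
    have ht1 : t < 1 := ht1
    have hmem : q + t • (n - q) ∈ drawing G :=
      hn ⟨1 - t, t, by linarith, ht0.le, by ring, by module⟩
    have h1 := hft hmem
    have h2 := hgt hmem
    simp only [map_add, map_smul, map_sub, smul_eq_mul] at h1 h2
    constructor
    · by_contra! h
      have := mul_neg_of_pos_of_neg ht0 (sub_neg.2 h)
      linarith
    · intro h
      have h3 := h2 (by rw [h]; ring)
      by_contra! h'
      have := mul_neg_of_pos_of_neg ht0 (sub_neg.2 h')
      linarith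
  by_cases hqS : q ∈ S
  · refine ⟨⟨q, hqS⟩, rfl, ?_⟩
    rintro ⟨a, b, c, hab, hac, hbc, ha, hb, hc, hq⟩
    have hnb : ∀ d : S, G.Adj d ⟨q, hqS⟩ → f q ≤ f d := fun d hd =>
      (hstar d (segment_subset_drawing (G := G) hd.symm)).1
    have hface := mem_convexHull_face (f := f) hq (by
      rintro x (rfl | rfl | rfl)
      exacts [hnb _ ha, hnb _ hb, hnb _ hc])
    obtain ⟨x, hx, hfx⟩ := convexHull_nonempty_iff.1 ⟨_, hface⟩
    have hxne : ∀ y ∈ ({↑a, ↑b, ↑c} : Set Plane), y ∈ S ∧ y ≠ q := by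
      rintro y (rfl | rfl | rfl)
      · exact ⟨a.2, fun h => ha.ne (Subtype.ext h)⟩
      · exact ⟨b.2, fun h => hb.ne (Subtype.ext h)⟩
      · exact ⟨c.2, fun h => hc.ne (Subtype.ext h)⟩
    -- Two neighbours on the line `f = f q` would be collinear with `q`. With only one there, `q`
    -- would have to equal it.
    have hsub : {y ∈ ({↑a, ↑b, ↑c} : Set Plane) | f y = f q} ⊆ {x} := fun y hy =>
      (hS.eq_or_eq hf0 (hxne x hx).1 hqS (hxne y hy.1).1 (hxne x hx).2 hfx hy.2).resolve_right
        (hxne y hy.1).2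
    have := convexHull_mono hsub hface
    rw [convexHull_singleton] at this
    exact (hxne x hx).2 this.symm
  · exfalso
    rcases hq with hq | ⟨a, b, hab, hq⟩
    · exact hqS hq
    have hseg := segment_subset_drawing hab
    have ha := hstar a (((convex_segment _ _).segment_subset hq (left_mem_segment _ _ _)).trans hseg)
    have hb := hstar b (((convex_segment _ _).segment_subset hq (right_mem_segment _ _ _)).trans hseg)
    rw [← insert_endpoints_openSegment] at hq
    rcases hq with rfl | rfl | ⟨s, t, hs, ht, hst, hq⟩
    · exact hqS a.2
    · exact hqS b.2
    obtain rfl : s = 1 - t := by linarith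
    -- Inside an edge, a functional at least `k q` at both ends is constant along it. Applied to
    -- `f`, then to the tie-breaker `g`, this collapses the edge.
    have eq_of : ∀ k : Plane →L[ℝ] ℝ, k q ≤ k a → k q ≤ k b → k a = k q := by
      intro k h1 h2
      have h3 := congrArg k hq
      simp only [map_add, map_smul, smul_eq_mul] at h3
      nlinarith [mul_nonneg hs.le (sub_nonneg.2 h1), mul_nonneg ht.le (sub_nonneg.2 h2)]
    have eq_of' : ∀ k : Plane →L[ℝ] ℝ, k q ≤ k a → k q ≤ k b → k b = k q := by
      intro k h1 h2
      have h3 := congrArg k hq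
      simp only [map_add, map_smul, smul_eq_mul] at h3
      nlinarith [mul_nonneg hs.le (sub_nonneg.2 h1), mul_nonneg ht.le (sub_nonneg.2 h2)]
    have hfa := eq_of f ha.1 hb.1
    have hfb := eq_of' f ha.1 hb.1
    have hga := eq_of g (ha.2 hfa) (hb.2 hfb)
    have : (a : Plane) - q = 0 := hfg _ (by simp [hfa]) (by simp [hga])
    exact hqS (sub_eq_zero.1 this ▸ a.2)

lemma segment_subset_union_segment {x y z : Plane} (hz : z ∈ segment ℝ x y) :
    segment ℝ x y ⊆ segment ℝ x z ∪ segment ℝ z y := by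
  rintro w ⟨r', r, hr', hr, hrr, rfl⟩
  obtain ⟨t', t, ht', ht, htt, rfl⟩ := hz
  obtain rfl : r' = 1 - r := by linarith
  obtain rfl : t' = 1 - t := by linarith
  rcases le_or_gt r t with h | h
  · left
    rcases ht.eq_or_lt with rfl | ht0
    · obtain rfl : r = 0 := le_antisymm h hr
      simp
    · have hm : r = r / t * t := (div_mul_cancel₀ r ht0.ne').symm
      generalize r / t = m at hm
      subst hm
      exact ⟨1 - m, m, by nlinarith, by nlinarith, by ring, by module⟩
  · right
    have h1 : 0 < 1 - t := by linarith
    have hm : (1 - r) = (1 - r) / (1 - t) * (1 - t) := (div_mul_cancel₀ _ h1.ne').symm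
    generalize (1 - r) / (1 - t) = m at hm
    obtain rfl : r = 1 - m * (1 - t) := by linarith
    exact ⟨m, 1 - m, by nlinarith, by nlinarith, by ring, by module⟩

/-- Two sides of a triangle in a bounded face: so is the third. -/

lemma IsFace.segment_trans {S : Finset Plane} (hS : GeneralPosition S) {G : SimpleGraph S}
    (hval : ∀ p : S, IsInteriorPoint p → IsValid G p) {F : Set Plane} (hF : IsFace G F)
    (hint : F ⊆ interior (convexHull ℝ (S : Set Plane))) {x y z : Plane}
    (hxz : segment ℝ x z ⊆ F) (hzy : segment ℝ z y ⊆ F) : segment ℝ x y ⊆ F := by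
  by_cases hlin : LinearIndependent ℝ ![x - z, y - z]
  swap
  · rcases eq_or_ne x z with rfl | hxz'
    · exact hzy
    rw [LinearIndependent.pair_iff' (sub_ne_zero.2 hxz')] at hlin
    push Not at hlin
    obtain ⟨c, hc⟩ := hlin
    have hcol : Collinear ℝ {x, z, y} := by
      rw [collinear_iff_of_mem (p₀ := z) (by simp)]
      refine ⟨x - z, ?_⟩
      rintro w (rfl | rfl | rfl)
      · exact ⟨1, by simp⟩
      · exact ⟨0, by simp⟩
      · exact ⟨c, by simp [hc]⟩
    rcases hcol.wbtw_or_wbtw_or_wbtw with h | h | h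
    · rw [← mem_segment_iff_wbtw] at h
      exact (segment_subset_union_segment h).trans (union_subset hxz hzy)
    · rw [← mem_segment_iff_wbtw, segment_symm] at h
      exact ((convex_segment _ _).segment_subset (left_mem_segment _ _ _) h).trans hxz
    · rw [← mem_segment_iff_wbtw, segment_symm] at h
      exact ((convex_segment _ _).segment_subset h (right_mem_segment _ _ _)).trans hzy
  obtain ⟨f, g, hfu, hfv, hgu, hgv, hfg⟩ := exists_coordinates hlin
  rw [map_sub] at hfu hfv hgu hgv
  set h := f + g
  have happ : ∀ w, h w = f w + g w := fun w => rfl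
  -- The triangle with corners `z`, `x`, `y` in coordinates centred at `z`; `h` is constant along
  -- the side `xy`.
  set T : Set Plane := {w | f z ≤ f w ∧ g z ≤ g w ∧ h w ≤ h z + 1}
  have hTsub : T ⊆ convexHull ℝ {z, x, y} := by
    rintro w ⟨h1, h2, h3⟩
    rw [happ, happ] at h3
    have hd := hfg (w - z)
    rw [map_sub, map_sub] at hd
    have hmem := (convex_convexHull ℝ {z, x, y}).sum_mem (t := Finset.univ)
      (w := ![1 - (f w - f z) - (g w - g z), f w - f z, g w - g z]) (z := ![z, x, y])
      (fun i _ => by fin_cases i <;> simp <;> linarith) (by simp [Fin.sum_univ_three]; ring)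
      (fun i _ => subset_convexHull ℝ _ (by fin_cases i <;> simp))
    convert hmem using 1
    refine (eq_add_of_sub_eq hd).trans ?_
    generalize f w - f z = a
    generalize g w - g z = b
    simp [Fin.sum_univ_three]
    module
  have hTint : T ⊆ interior (convexHull ℝ (S : Set Plane)) := by
    refine hTsub.trans (convexHull_min ?_ (convex_convexHull ℝ _).interior)
    rintro w (rfl | rfl | rfl)
    · exact hint (hxz (right_mem_segment _ _ _))
    · exact hint (hxz (left_mem_segment _ _ _))
    · exact hint (hzy (right_mem_segment _ _ _))
  have hTclosed : IsClosed T := by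
    refine (isClosed_le continuous_const f.continuous).inter
      ((isClosed_le continuous_const g.continuous).inter (isClosed_le h.continuous continuous_const))
  have hTcomp : IsCompact T :=
    ((Set.toFinite _).isCompact_convexHull ℝ).of_isClosed_subset hTclosed hTsub
  rcases (T ∩ drawing G).eq_empty_or_nonempty with hempty | hne
  · refine hF.subset_of_isPreconnected (convex_segment _ _).isPreconnected ?_
      (left_mem_segment _ _ _) (hxz (left_mem_segment _ _ _))
    rintro w ⟨s, t, hs, ht, hst, rfl⟩ hw
    refine Set.eq_empty_iff_forall_notMem.1 hempty _ ⟨?_, hw⟩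
    obtain rfl : s = 1 - t := by linarith
    refine ⟨?_, ?_, ?_⟩ <;> simp only [happ, map_add, map_smul, smul_eq_mul] <;> nlinarith
  obtain ⟨q, ⟨hqT, hqG⟩, hqmin, hqmin'⟩ :=
    exists_lex_min (hTcomp.inter_right (isClosed_drawing G)) hne h f
  obtain ⟨hqf, hqg, hqh⟩ := hqT
  have hqFG : q ∉ F := fun hq => hF.subset_compl hq hqG
  have hfpos : f z < f q := by
    refine lt_of_le_of_ne hqf fun heq => hqFG (hzy ?_)
    have hd := hfg (q - z)
    rw [map_sub, map_sub, ← heq, sub_self, zero_smul, zero_add] at hd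
    rw [happ, happ] at hqh
    refine ⟨1 - (g q - g z), g q - g z, by linarith, by linarith, by ring, ?_⟩
    rw [sub_eq_iff_eq_add] at hd
    exact Eq.trans (by module) hd.symm
  have hgpos : g z < g q := by
    refine lt_of_le_of_ne hqg fun heq => hqFG (hxz ?_)
    have hd := hfg (q - z)
    rw [map_sub, map_sub, ← heq, sub_self, zero_smul, add_zero] at hd
    rw [happ, happ] at hqh
    refine ⟨f q - f z, 1 - (f q - f z), by linarith, by linarith, by ring, ?_⟩
    rw [sub_eq_iff_eq_add] at hd
    exact Eq.trans (by module) hd.symm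
  -- Since `q` is off the sides at `z`, only the side `xy` could cut off nearby points, and it keeps
  -- those with `h w ≤ h q`. So minimality over `T` is local minimality in the whole drawing.
  have hnear : ∀ᶠ w in 𝓝 q, h w ≤ h q → w ∈ T := by
    filter_upwards [f.continuous.continuousAt.eventually (lt_mem_nhds hfpos),
      g.continuous.continuousAt.eventually (lt_mem_nhds hgpos)] with w hw1 hw2 hw
    exact ⟨hw1.le, hw2.le, hw.trans hqh⟩
  obtain ⟨p, rfl, hp⟩ : ∃ p : S, (p : Plane) = q ∧ ¬ IsValid G p := by
    refine not_isValid_of_lex_min (f := h) (g := f) hS (fun w hw1 hw2 => ?_) hqG ?_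
      (hnear.mono fun w hw hwG => ?_) (hnear.mono fun w hw hwG hwq => ?_)
    · rw [happ] at hw1
      rw [hfg w, hw2, show g w = 0 by linarith]
      simp
    · intro h0
      have := happ (x - z)
      rw [h0, zero_apply, map_sub, map_sub, hfu, hgu] at this
      norm_num at this
    · by_contra! hlt
      exact not_le.2 hlt (hqmin w ⟨hw hlt.le, hwG⟩)
    · exact hqmin' w ⟨hw hwq.le, hwG⟩ hwq
  exact absurd (hval p (hTint ⟨hqf, hqg, hqh⟩)) hp

lemma IsFace.convex {S : Finset Plane} (hS : GeneralPosition S) {G : SimpleGraph S}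
    (hval : ∀ p : S, IsInteriorPoint p → IsValid G p) {F : Set Plane} (hF : IsFace G F)
    (hint : F ⊆ interior (convexHull ℝ (S : Set Plane))) : Convex ℝ F := by
  rw [convex_iff_segment_subset]
  intro x hx y hy
  refine hF.isPreconnected.induction₂ (fun x y => segment ℝ x y ⊆ F) (fun z hz => ?_)
    (fun x z y _ _ _ hxz hzy => hF.segment_trans hS hval hint hxz hzy)
    (fun x y _ _ h => segment_symm ℝ x y ▸ h) hx hy
  obtain ⟨r, hr, hball⟩ := Metric.isOpen_iff.1 hF.isOpen z hz
  filter_upwards [nhdsWithin_le_nhds (Metric.ball_mem_nhds z hr)] with w hw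
  exact ((convex_ball z r).segment_subset (Metric.mem_ball_self hr) hw).trans hball

/-! ### Convex faces are polygons -/

/-- The corners of a convex face are vertices. -/

lemma IsFace.extremePoints_subset {S : Finset Plane} {G : SimpleGraph S}
    (hG : IsCrossingFree G) {F : Set Plane} (hF : IsFace G F) :
    (closure F).extremePoints ℝ ⊆ S := by
  intro e he
  have hlocal := eventually_mem_drawing G e
  by_contra heS
  -- a line through `e` off which the drawing is empty near `e`
  obtain ⟨f, v, hf, hv0, hv, hfree⟩ : ∃ (f : Plane →L[ℝ] ℝ) (v : Plane), f ≠ 0 ∧ v ≠ 0 ∧ f v = 0 ∧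
      ∀ᶠ x in 𝓝 e, x ∈ drawing G → f x = f e := by
    by_cases hedge : ∃ a b : S, G.Adj a b ∧ e ∈ segment ℝ (a : Plane) b
    · obtain ⟨a, b, hab, heab⟩ := hedge
      have hne : (b : Plane) - a ≠ 0 := sub_ne_zero.2 fun h => hab.ne (Subtype.ext h.symm)
      obtain ⟨n, hn0, hn⟩ := exists_ker_vector (innerSL ℝ ((b : Plane) - a))
      have hconst : ∀ x ∈ segment ℝ (a : Plane) b, innerSL ℝ n x = innerSL ℝ n (a : Plane) := by
        rintro x ⟨s, t, -, -, hst, rfl⟩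
        have h1 : innerSL ℝ n ((b : Plane) - a) = 0 := by
          rw [innerSL_apply_apply, real_inner_comm]
          exact hn
        obtain rfl : s = 1 - t := by linarith
        rw [map_sub] at h1
        simp only [map_add, map_smul, smul_eq_mul]
        linear_combination t * h1
      refine ⟨innerSL ℝ n, b - a, ?_, hne, ?_, ?_⟩
      · intro h
        have := congrArg (fun k : Plane →L[ℝ] ℝ => k n) h
        simp [hn0] at this
      · rw [map_sub, hconst b (right_mem_segment _ _ _), sub_self]
      · filter_upwards [hlocal] with x hx hxG
        rcases hx hxG with rfl | ⟨c, d, hcd, hecd, hxcd⟩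
        · rfl
        -- Crossing-freeness leaves only one edge through a point that is not a vertex.
        · have hsym : s(a, b) = s(c, d) := by
            by_contra hne
            rcases (hG a b c d hab hcd hne ⟨heab, hecd⟩).1 with rfl | rfl
            · exact heS a.2
            · exact heS b.2
          have hxab : x ∈ segment ℝ (a : Plane) b := by
            rcases Sym2.eq_iff.1 hsym with ⟨rfl, rfl⟩ | ⟨rfl, rfl⟩
            · exact hxcd
            · rwa [segment_symm]
          rw [hconst x hxab, hconst e heab]
    · obtain ⟨v, hv0⟩ := exists_ne (0 : Plane)
      obtain ⟨n, hn0, hn⟩ := exists_ker_vector (innerSL ℝ v)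
      refine ⟨innerSL ℝ n, v, ?_, hv0, ?_, ?_⟩
      · intro h
        have := congrArg (fun k : Plane →L[ℝ] ℝ => k n) h
        simp [hn0] at this
      · rw [innerSL_apply_apply, real_inner_comm]
        exact hn
      · filter_upwards [hlocal] with x hx hxG
        rcases hx hxG with rfl | ⟨c, d, hcd, hecd, -⟩
        · rfl
        · exact absurd ⟨c, d, hcd, hecd⟩ hedge
  obtain ⟨r, hr, hball⟩ := Metric.eventually_nhds_iff_ball.1 hfree
  obtain ⟨w, hwr, hwF, hfw⟩ : ∃ w ∈ Metric.ball e r, w ∈ F ∧ f w ≠ f e := by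
    obtain ⟨w, hwr, hwF⟩ := mem_closure_iff.1 he.1 _ Metric.isOpen_ball (Metric.mem_ball_self hr)
    by_cases hw : f w = f e
    · obtain ⟨u, hu⟩ := exists_apply_neg hf
      obtain ⟨t, ⟨ht1, ht2⟩, ht0⟩ := (((tendsto_add_smul w u).eventually
        (inter_mem (Metric.isOpen_ball.mem_nhds hwr) (hF.isOpen.mem_nhds hwF))).and
        self_mem_nhdsWithin).exists
      refine ⟨w + t • u, ht1, ht2, ?_⟩
      simp [hw, (ne_of_gt ht0 : t ≠ 0), hu.ne]
    · exact ⟨w, hwr, hwF, hw⟩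
  -- the open half-disc at `e` containing `w`
  have hhalf : ∃ H : Set Plane, H ⊆ F ∧ ∀ x ∈ Metric.ball e r, f x = f e →
      ∀ t ∈ Ioc (0 : ℝ) 1, x + t • (w - x) ∈ H := by
    have hin : ∀ x ∈ Metric.ball e r, ∀ t ∈ Ioc (0 : ℝ) 1, x + t • (w - x) ∈ Metric.ball e r :=
      fun x hx t ht => (convex_ball e r).add_smul_sub_mem hx hwr ⟨ht.1.le, ht.2⟩
    rcases lt_or_gt_of_ne hfw with hlt | hlt
    · refine ⟨Metric.ball e r ∩ {x | f x < f e}, hF.subset_of_isPreconnected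
        ((convex_ball e r).inter (convex_halfSpace_lt f.toLinearMap.isLinear _)).isPreconnected
        (fun x hx hxG => ne_of_lt hx.2 (hball x hx.1 hxG)) ⟨hwr, hlt⟩ hwF, fun x hx hfx t ht =>
        ⟨hin x hx t ht, ?_⟩⟩
      simp only [mem_ofPred_eq, map_add, map_smul, map_sub, smul_eq_mul, hfx]
      linarith [mul_neg_of_pos_of_neg ht.1 (sub_neg.2 hlt)]
    · refine ⟨Metric.ball e r ∩ {x | f e < f x}, hF.subset_of_isPreconnected
        ((convex_ball e r).inter (convex_halfSpace_gt f.toLinearMap.isLinear _)).isPreconnected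
        (fun x hx hxG => ne_of_gt hx.2 (hball x hx.1 hxG)) ⟨hwr, hlt⟩ hwF, fun x hx hfx t ht =>
        ⟨hin x hx t ht, ?_⟩⟩
      simp only [mem_ofPred_eq, map_add, map_smul, map_sub, smul_eq_mul, hfx]
      linarith [mul_pos ht.1 (sub_pos.2 hlt)]
  obtain ⟨H, hHF, hH⟩ := hhalf
  -- The diameter bounding the half-disc lies in `closure F`, so `e` is the midpoint of two other
  -- points there and is not extreme.
  have hcl : ∀ x ∈ Metric.ball e r, f x = f e → x ∈ closure F := fun x hx hfx =>
    mem_closure_of_tendsto (tendsto_add_smul x (w - x)) <| by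
      filter_upwards [Ioc_mem_nhdsGT (zero_lt_one' ℝ)] with t ht using hHF (hH x hx hfx t ht)
  have hmem := fun v' => (tendsto_add_smul e v').eventually (Metric.ball_mem_nhds _ hr)
  obtain ⟨t, ⟨ht1, ht2⟩, ht0⟩ := (((hmem v).and (hmem (-v))).and self_mem_nhdsWithin).exists
  have := he.2 (hcl _ ht1 (by simp [hv])) (hcl _ ht2 (by simp [hv]))
    ⟨1 / 2, 1 / 2, by norm_num, by norm_num, by norm_num, by module⟩
  simp [(ne_of_gt ht0 : t ≠ 0), hv0] at this

/-- By Krein–Milman the closure is the hull of its finitely many extreme points, and an open convex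
set is the interior of its closure. -/
lemma IsFace.isConvexPolygon {S : Finset Plane} {G : SimpleGraph S}
    (hG : IsCrossingFree G) {F : Set Plane} (hF : IsFace G F) (hconv : Convex ℝ F)
    (hb : Bornology.IsBounded F) : IsConvexPolygon F := by
  classical
  refine ⟨hF.nonempty, S.filter (· ∈ (closure F).extremePoints ℝ), ?_⟩
  have hV : ((S.filter (· ∈ (closure F).extremePoints ℝ) : Finset Plane) : Set Plane) =
      (closure F).extremePoints ℝ := by
    ext x
    simpa using fun hx => hF.extremePoints_subset hG hx
  have hKM := closure_convexHull_extremePoints hb.isCompact_closure hconv.closure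
  rw [← hV, ((Finset.finite_toSet _).isClosed_convexHull ℝ).closure_eq] at hKM
  rw [hKM, hconv.interior_closure_eq_interior_of_nonempty_interior
    (by rw [hF.isOpen.interior_eq]; exact hF.nonempty), hF.isOpen.interior_eq]

end PlaneGraph

theorem mainTheorem10 (S : Finset PlaneGraph.Plane) (hS : PlaneGraph.GeneralPosition S)
    (hcard : S.card ≠ 1) (G : SimpleGraph S) (hG : PlaneGraph.IsCrossingFree G)
    (hhull : PlaneGraph.ContainsHullEdges G) :
    PlaneGraph.IsConvexDecomposition G ↔
      ∀ p : S, PlaneGraph.IsInteriorPoint p → PlaneGraph.IsValid G p := by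
  refine ⟨fun h p hp => PlaneGraph.isValid_of_isConvexDecomposition hS h hp, fun hval =>
    ⟨hG, hhull, fun F hF hb => ?_, fun p => ?_⟩⟩
  · exact hF.isConvexPolygon hG (hF.convex hS hval
      (hF.subset_interior (PlaneGraph.frontier_subset_drawing hS hhull) hb)) hb
  · by_cases hp : PlaneGraph.IsInteriorPoint p
    · obtain ⟨a, -, -, -, -, -, ha, -⟩ := hval p hp
      exact ⟨a, ha.symm⟩
    · obtain ⟨q, hq⟩ := PlaneGraph.exists_isHullEdge hcard p hp
      exact ⟨q, hhull p q hq⟩
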